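/- Let $A\in\mathbb R^{n\times n}$, $B\in\mathbb R^{n\times m}$, and let $Q\in\mathbb R^{n\times n}$ be symmetric. Suppose that $(A,B)$ is stabilizable, i.e. there is $F\in\mathbb R^{m\times n}$ such that all eigenvalues of $A+BF$ have negative real part, and that $Q\ge 0$ (positive semidefinite). Let $\mathcal C=\operatorname{Im}B+A\operatorname{Im}B+\dots+A^{n-1}\operatorname{Im}B$ be the controllable subspace, $n_1=\dim\mathcal C$, and let $\mathbb R^n=\mathcal C\oplus\mathcal X_2$ for an arbitrary complement $\mathcal X_2$. Let $T$ be an invertible matrix whose first $n_1$ columns form a basis of $\mathcal C$ and whose remaining columns form a basis of $\mathcal X_2$, and write $$T^{-1}AT=\begin{bmatrix}A_1&A_{12}\\0&A_2\end{bmatrix},\qquad T^{-1}B=\begin{bmatrix}B_1\\0\end{bmatrix},\qquad T^{\top}QT=\begin{bmatrix}Q_1&Q_{12}\\Q_{12}^{\top}&Q_2\end{bmatrix}.$$ Let $\partial\Gamma_1$ be the set of symmetric $K_1\in\mathbb R^{n_1\times n_1}$ with $$A_1^{\top}K_1+K_1A_1+Q_1-K_1B_1B_1^{\top}K_1=0 .$$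 Then $\partial\Gamma_1$ has a maximal element $K_1^+$ and a minimal element $K_1^-$, i.e. $K_1^\pm\in\partial\Gamma_1$ and $K_1^-\le K_1\le K_1^+$ for all $K_1\in\partial\Gamma_1$ (where $K\le L$ means that $L-K$ is positive semidefinite); these are unique. With $\Delta_1:=K_1^+-K_1^-$, every eigenvalue $\lambda\in\mathbb C$ of $A$ with $\operatorname{Re}\lambda=0$ is $(Q,A)$-observable, i.e. $\operatorname{rank}\begin{bmatrix}A-\lambda I\\Q\end{bmatrix}=n$, if and only if $\Delta_1$ is positive definite. -/

import Mathlib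

namespace LQ

/-- The set `σ(M)` of (complex) eigenvalues of a real square matrix. -/
def eigenvalues {n : ℕ} (M : Matrix (Fin n) (Fin n) ℝ) : Set ℂ :=
  spectrum ℂ (M.map (algebraMap ℝ ℂ))

/-- `(A, B)` is stabilizable: some state feedback `u = F x` places all eigenvalues of the closed
loop `A + B F` in the open left half plane. -/
def Stabilizable {n m : ℕ} (A : Matrix (Fin n) (Fin n) ℝ) (B : Matrix (Fin n) (Fin m) ℝ) : Prop :=
  ∃ F : Matrix (Fin m) (Fin n) ℝ, ∀ s ∈ eigenvalues (A + B * F), s.re < 0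

/-- The controllable subspace `⟨A | Im B⟩ = Im B + A Im B + ⋯ + A ^ (n - 1) Im B`. -/
def controllableSubspace {n m : ℕ} (A : Matrix (Fin n) (Fin n) ℝ) (B : Matrix (Fin n) (Fin m) ℝ) :
    Submodule ℝ (Fin n → ℝ) :=
  ⨆ i : Fin n, (LinearMap.range B.mulVecLin).map (A ^ (i : ℕ)).mulVecLin

/-- `s` is `(C, A)`-observable: the complex matrix with row blocks `A - s I` and `C` has full
column rank. (Meant for eigenvalues `s` of `A`; every other `s` satisfies it trivially.) -/
def ObservableAt {n p : ℕ} (C : Matrix (Fin p) (Fin n) ℝ) (A : Matrix (Fin n) (Fin n) ℝ)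
    (s : ℂ) : Prop :=
  (Matrix.fromRows (A.map (algebraMap ℝ ℂ) - s • (1 : Matrix (Fin n) (Fin n) ℂ))
    (C.map (algebraMap ℝ ℂ))).rank = n

/-- The set `∂Γ` of symmetric real solutions `K` of the algebraic Riccati equation
`Aᵀ K + K A + Q - K B Bᵀ K = 0`. -/
def areSolutions {n m : ℕ} (A : Matrix (Fin n) (Fin n) ℝ) (B : Matrix (Fin n) (Fin m) ℝ)
    (Q : Matrix (Fin n) (Fin n) ℝ) : Set (Matrix (Fin n) (Fin n) ℝ) :=
  {K | K.IsSymm ∧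
    A.transpose * K + K * A + Q - K * B * B.transpose * K = 0}

/-- `K` is the maximal element of the set `S` of symmetric matrices, in the order in which
`L ≤ K` means that `K - L` is positive semidefinite. -/
def IsMaximalElement {n : ℕ} (S : Set (Matrix (Fin n) (Fin n) ℝ))
    (K : Matrix (Fin n) (Fin n) ℝ) : Prop :=
  K ∈ S ∧ ∀ L ∈ S, (K - L).PosSemidef

/-- `K` is the minimal element of the set `S` of symmetric matrices, in the same order. -/
def IsMinimalElement {n : ℕ} (S : Set (Matrix (Fin n) (Fin n) ℝ))
    (K : Matrix (Fin n) (Fin n) ℝ) : Prop :=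
  K ∈ S ∧ ∀ L ∈ S, (L - K).PosSemidef

section Kalman

variable {n n₁ n₂ m : ℕ}

/-- `b` is a basis of `ℝⁿ` adapted to a decomposition `ℝⁿ = 𝒞 ⊕ 𝒳₂` with `𝒞` the controllable
subspace: the first group of basis vectors spans `𝒞` (hence has `n₁ = dim 𝒞` elements), and the
second one spans the complement `𝒳₂`, which may be any complement. -/
def IsKalmanBasis (A : Matrix (Fin n) (Fin n) ℝ) (B : Matrix (Fin n) (Fin m) ℝ)
    (b : Module.Basis (Fin n₁ ⊕ Fin n₂) ℝ (Fin n → ℝ)) : Prop :=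
  Submodule.span ℝ (Set.range fun i : Fin n₁ => b (Sum.inl i)) = controllableSubspace A B

/-- The matrix `T` whose columns are the basis vectors. -/
noncomputable def basisMatrix (b : Module.Basis (Fin n₁ ⊕ Fin n₂) ℝ (Fin n → ℝ)) :
    Matrix (Fin n) (Fin n₁ ⊕ Fin n₂) ℝ :=
  (Pi.basisFun ℝ (Fin n)).toMatrix b

/-- The inverse `T⁻¹` of `basisMatrix b`. -/
noncomputable def basisMatrixInv (b : Module.Basis (Fin n₁ ⊕ Fin n₂) ℝ (Fin n → ℝ)) :
    Matrix (Fin n₁ ⊕ Fin n₂) (Fin n) ℝ :=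
  b.toMatrix (Pi.basisFun ℝ (Fin n))

/-- The upper left block `A₁` of `T⁻¹ A T`. -/
noncomputable def blockA (b : Module.Basis (Fin n₁ ⊕ Fin n₂) ℝ (Fin n → ℝ))
    (A : Matrix (Fin n) (Fin n) ℝ) : Matrix (Fin n₁) (Fin n₁) ℝ :=
  (basisMatrixInv b * A * basisMatrix b).toBlocks₁₁

/-- The upper block `B₁` of `T⁻¹ B`. -/
noncomputable def blockB (b : Module.Basis (Fin n₁ ⊕ Fin n₂) ℝ (Fin n → ℝ))
    (B : Matrix (Fin n) (Fin m) ℝ) : Matrix (Fin n₁) (Fin m) ℝ :=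
  (basisMatrixInv b * B).toRows₁

/-- The upper left block `Q₁` of `Tᵀ Q T`, the matrix of the quadratic form `Q` in the basis. -/
noncomputable def blockQ (b : Module.Basis (Fin n₁ ⊕ Fin n₂) ℝ (Fin n → ℝ))
    (Q : Matrix (Fin n) (Fin n) ℝ) : Matrix (Fin n₁) (Fin n₁) ℝ :=
  ((basisMatrix b).transpose * Q * basisMatrix b).toBlocks₁₁

end Kalman

end LQ

/-! The problem reduces to the controllable block. There `(A₁, B₁)` is controllable
(`IsKalmanBasis.controllable`), while feedback cannot move the eigenvalues of `A₂`, so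
stabilizability puts them in the open left half plane. Imaginary eigenvectors of `A` therefore lie
in the controllable subspace, where `Q` and `Q₁` have the same kernel
(`IsKalmanBasis.imaginaryObservable_iff`).

For a controllable pair, with `S = B₁ B₁ᵀ`, Bass' feedback and a Newton argument give a stabilizing
solution when `Q` is positive definite. Letting `Q + ε I` tend to `Q` gives the maximal solution
`K`, whose closed loop has spectrum in `Re ≤ 0` (`exists_maximal_riccati`). The same result for `-A`
gives the minimal solution `L`, with closed-loop spectrum in `Re ≥ 0`.

The kernel of `Δ = K - L` is invariant under `A - S K`, and both closed loops agree on it. If it is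
nonzero, it contains an eigenvector `x` whose eigenvalue has real part zero. A Lyapunov identity
then forces `S K x = 0` and `Q x = 0`, so `x` is an unobservable eigenvector of `A`. Conversely,
controllability makes every symmetric solution, hence also `Δ`, vanish on such vectors
(`riccati_solution_mulVec_eq_zero`). -/

namespace LQ

open Matrix Filter Topology

/-! ### Lyapunov equations and quadratic stability. -/

section Lyapunov

variable {ι : Type*} [Fintype ι]

theorem dotProduct_transpose_mulVec (A : Matrix ι ι ℝ) (v w : ι → ℝ) :
    v ⬝ᵥ (Aᵀ *ᵥ w) = (A *ᵥ v) ⬝ᵥ w := by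
  rw [dotProduct_mulVec, vecMul_transpose]

theorem _root_.Matrix.IsSymm.dotProduct_mulVec_comm {X : Matrix ι ι ℝ} (hX : X.IsSymm)
    (v w : ι → ℝ) : v ⬝ᵥ (X *ᵥ w) = (X *ᵥ v) ⬝ᵥ w := by
  rw [← dotProduct_transpose_mulVec, hX.eq]

theorem posSemidef_iff_isSymm {X : Matrix ι ι ℝ} :
    X.PosSemidef ↔ X.IsSymm ∧ ∀ v, 0 ≤ v ⬝ᵥ (X *ᵥ v) := by
  rw [posSemidef_iff_dotProduct_mulVec]
  simp [IsHermitian, IsSymm, conjTranspose_eq_transpose_of_trivial]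

theorem posDef_iff_isSymm {X : Matrix ι ι ℝ} :
    X.PosDef ↔ X.IsSymm ∧ ∀ v, v ≠ 0 → 0 < v ⬝ᵥ (X *ᵥ v) := by
  rw [posDef_iff_dotProduct_mulVec]
  simp [IsHermitian, IsSymm, conjTranspose_eq_transpose_of_trivial]

theorem _root_.Matrix.PosSemidef.isSymm {X : Matrix ι ι ℝ} (hX : X.PosSemidef) : X.IsSymm :=
  (posSemidef_iff_isSymm.1 hX).1

theorem _root_.Matrix.PosSemidef.mulVec_eq_zero {X : Matrix ι ι ℝ} (hX : X.PosSemidef)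
    {v : ι → ℝ} (hv : v ⬝ᵥ (X *ᵥ v) = 0) : X *ᵥ v = 0 :=
  (hX.dotProduct_mulVec_zero_iff v).1 (by simpa using hv)

theorem posDef_of_forall_mulVec_ne_zero {X : Matrix ι ι ℝ} (hX : X.PosSemidef)
    (h : ∀ v, X *ᵥ v = 0 → v = 0) : X.PosDef :=
  posDef_iff_isSymm.2 ⟨hX.isSymm, fun v hv =>
    lt_of_le_of_ne ((posSemidef_iff_isSymm.1 hX).2 v) fun h0 => hv (h v (hX.mulVec_eq_zero h0.symm))⟩

theorem eq_zero_of_posSemidef_neg {X : Matrix ι ι ℝ} (h : X.PosSemidef) (h' : (-X).PosSemidef) :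
    X = 0 := by
  classical
  have h0 : ∀ v, X *ᵥ v = 0 := fun v => h.mulVec_eq_zero (le_antisymm
    (by simpa [neg_mulVec] using (posSemidef_iff_isSymm.1 h').2 v) ((posSemidef_iff_isSymm.1 h).2 v))
  exact Matrix.ext_of_mulVec_single fun i => by rw [h0, zero_mulVec]

/-- The quadratic form of `Mᵀ X + X M`. -/
theorem dotProduct_lyapunov {X : Matrix ι ι ℝ} (hX : X.IsSymm) (M : Matrix ι ι ℝ) (v : ι → ℝ) :
    v ⬝ᵥ ((Mᵀ * X + X * M) *ᵥ v) = 2 * ((X *ᵥ v) ⬝ᵥ (M *ᵥ v)) := by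
  rw [add_mulVec, dotProduct_add, ← mulVec_mulVec, ← mulVec_mulVec, dotProduct_transpose_mulVec,
    hX.dotProduct_mulVec_comm v (M *ᵥ v), dotProduct_comm (M *ᵥ v)]
  ring

/-- `M` admits a strict quadratic Lyapunov function for `x' = M x`. -/
def LyapunovStable (M : Matrix ι ι ℝ) : Prop :=
  ∃ P : Matrix ι ι ℝ, P.PosDef ∧ (-(Mᵀ * P + P * M)).PosDef

/-- Minimize the quotient of the forms of `X` and `P`. If the minimum `r` is negative, a minimizer
`u` satisfies `X u = r P u`, so `⟨X u, M u⟩ = r ⟨P u, M u⟩ > 0`, against the hypothesis. This avoids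
matrix exponentials. -/
theorem LyapunovStable.posSemidef {M X : Matrix ι ι ℝ} (hM : LyapunovStable M) (hX : X.IsSymm)
    (h : (-(Mᵀ * X + X * M)).PosSemidef) : X.PosSemidef := by
  obtain ⟨P, hP, hPM⟩ := hM
  have hPM' : ∀ v, v ≠ 0 → (P *ᵥ v) ⬝ᵥ (M *ᵥ v) < 0 := fun v hv => by
    have := (posDef_iff_isSymm.1 hPM).2 v hv
    rw [neg_mulVec, dotProduct_neg, dotProduct_lyapunov hP.posSemidef.isSymm] at this
    linarith
  have hXM : ∀ v, (X *ᵥ v) ⬝ᵥ (M *ᵥ v) ≤ 0 := fun v => by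
    have := (posSemidef_iff_isSymm.1 h).2 v
    rw [neg_mulVec, dotProduct_neg, dotProduct_lyapunov hX] at this
    linarith
  have hPpos := (posDef_iff_isSymm.1 hP).2
  refine posSemidef_iff_isSymm.2 ⟨hX, ?_⟩
  by_contra! hneg
  obtain ⟨v₀, hv₀⟩ := hneg
  have hv₀0 : v₀ ≠ 0 := by rintro rfl; simp at hv₀
  set r : (ι → ℝ) → ℝ := fun v => (v ⬝ᵥ (X *ᵥ v)) / (v ⬝ᵥ (P *ᵥ v)) with hr
  have hne : ∀ v ∈ Metric.sphere (0 : ι → ℝ) 1, v ≠ 0 := fun v hv h0 => by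
    rw [mem_sphere_zero_iff_norm, h0, norm_zero] at hv
    exact zero_ne_one hv
  have hcont : ContinuousOn r (Metric.sphere 0 1) := by
    refine ContinuousOn.div (by fun_prop) (by fun_prop) fun v hv => (hPpos v (hne v hv)).ne'
  have hscale : ∀ v : ι → ℝ, v ≠ 0 → ‖v‖⁻¹ • v ∈ Metric.sphere (0 : ι → ℝ) 1 ∧
      r (‖v‖⁻¹ • v) = r v := fun v hv => by
    have hn : ‖v‖ ≠ 0 := norm_ne_zero_iff.2 hv
    refine ⟨by simp [norm_smul, hn], ?_⟩
    simp only [hr, mulVec_smul, dotProduct_smul, smul_dotProduct, smul_eq_mul]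
    have := (hPpos v hv).ne'
    field_simp
  obtain ⟨u, hu, hmin⟩ := (isCompact_sphere (0 : ι → ℝ) 1).exists_isMinOn
    ⟨_, (hscale v₀ hv₀0).1⟩ hcont
  have hmin' : ∀ v, v ≠ 0 → r u ≤ r v := fun v hv => (hscale v hv).2 ▸ hmin (hscale v hv).1
  have hu0 := hne u hu
  have hneg : r u < 0 := (hmin' v₀ hv₀0).trans_lt (div_neg_of_neg_of_pos hv₀ (hPpos v₀ hv₀0))
  have hpsd : (X - r u • P).PosSemidef := by
    refine posSemidef_iff_isSymm.2 ⟨hX.sub (hP.posSemidef.isSymm.smul _), fun v => ?_⟩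
    rw [sub_mulVec, smul_mulVec, dotProduct_sub, dotProduct_smul, smul_eq_mul, sub_nonneg]
    rcases eq_or_ne v 0 with rfl | hv
    · simp
    · exact (le_div_iff₀ (hPpos v hv)).1 (hmin' v hv)
  have hker : (X - r u • P) *ᵥ u = 0 := by
    refine hpsd.mulVec_eq_zero ?_
    rw [sub_mulVec, smul_mulVec, dotProduct_sub, dotProduct_smul, smul_eq_mul, sub_eq_zero, hr]
    exact (div_mul_cancel₀ _ (hPpos u hu0).ne').symm
  have hXu : X *ᵥ u = r u • (P *ᵥ u) := by
    rwa [sub_mulVec, smul_mulVec, sub_eq_zero] at hker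
  have h1 := hXM u
  rw [hXu, smul_dotProduct, smul_eq_mul] at h1
  nlinarith [hPM' u hu0]

/-- The Lyapunov equation of a stable matrix is solvable in symmetric matrices. -/
theorem LyapunovStable.exists_solution {M W : Matrix ι ι ℝ} (hM : LyapunovStable M)
    (hW : W.PosSemidef) : ∃ X : Matrix ι ι ℝ, X.PosSemidef ∧ Mᵀ * X + X * M + W = 0 := by
  let S : Submodule ℝ (Matrix ι ι ℝ) :=
    { carrier := {X | X.IsSymm}
      add_mem' := fun h h' => h.add h'
      zero_mem' := isSymm_zero
      smul_mem' := fun c _ h => h.smul c }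
  let L : S →ₗ[ℝ] S :=
    { toFun := fun X => ⟨Mᵀ * X.1 + X.1 * M, by
        have hX : X.1ᵀ = X.1 := X.2
        change (Mᵀ * X.1 + X.1 * M)ᵀ = _
        rw [transpose_add, transpose_mul, transpose_mul, transpose_transpose, hX, add_comm]⟩
      map_add' := fun X Y => Subtype.ext (by
        change Mᵀ * (X.1 + Y.1) + (X.1 + Y.1) * M = (Mᵀ * X.1 + X.1 * M) + (Mᵀ * Y.1 + Y.1 * M)
        noncomm_ring)
      map_smul' := fun c X => Subtype.ext (by
        change Mᵀ * (c • X.1) + (c • X.1) * M = c • (Mᵀ * X.1 + X.1 * M)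
        rw [mul_smul_comm, smul_mul_assoc, smul_add]) }
  -- A homogeneous solution and its negative are both positive semidefinite, so it is zero;
  -- injectivity gives surjectivity in finite dimension.
  have hinj : Function.Injective L := by
    rw [← LinearMap.ker_eq_bot, LinearMap.ker_eq_bot']
    intro X hX
    have h0 : Mᵀ * X.1 + X.1 * M = 0 := congrArg Subtype.val hX
    refine Subtype.ext (eq_zero_of_posSemidef_neg (hM.posSemidef X.2 ?_) (hM.posSemidef
      (IsSymm.neg X.2) ?_))
    · rw [h0, neg_zero]; exact PosSemidef.zero
    · rw [mul_neg, neg_mul, ← neg_add, h0, neg_zero, neg_zero]; exact PosSemidef.zero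
  obtain ⟨X, hX⟩ := (LinearMap.injective_iff_surjective.1 hinj) ⟨-W, hW.isSymm.neg⟩
  have hX' : Mᵀ * X.1 + X.1 * M = -W := congrArg Subtype.val hX
  refine ⟨X.1, hM.posSemidef X.2 ?_, ?_⟩
  · rw [hX', neg_neg]; exact hW
  · rw [hX', neg_add_cancel]

end Lyapunov

/-! ### Riccati comparison and stabilizing solutions. -/

section Riccati

variable {ι : Type*} [Fintype ι]

/-- The Riccati map, with `S` in the role of `B Bᵀ`. -/
def riccati (A S Q K : Matrix ι ι ℝ) : Matrix ι ι ℝ :=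
  Aᵀ * K + K * A + Q - K * S * K

theorem closedLoop_transpose (A : Matrix ι ι ℝ) {S K : Matrix ι ι ℝ} (hS : S.IsSymm)
    (hK : K.IsSymm) : (A - S * K)ᵀ = Aᵀ - K * S := by
  rw [transpose_sub, transpose_mul, hS.eq, hK.eq]

theorem _root_.Matrix.PosSemidef.symm_mul_mul {S H : Matrix ι ι ℝ} (hS : S.PosSemidef)
    (hH : H.IsSymm) : (H * S * H).PosSemidef := by
  have := hS.mul_mul_conjTranspose_same H
  rwa [conjTranspose_eq_transpose_of_trivial, hH.eq] at this

/-- If `K` solves a Riccati equation whose constant term is positive definite, the closed loop is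
stable. -/
theorem lyapunovStable_closedLoop {A S Q K : Matrix ι ι ℝ} (hS : S.PosSemidef) (hQ : Q.PosDef)
    (hK : K.PosSemidef) {R : Matrix ι ι ℝ} (hR : R.PosSemidef) (h : riccati A S Q K = -R) :
    LyapunovStable (A - S * K) := by
  have e : -((A - S * K)ᵀ * K + K * (A - S * K)) = Q + (K * S * K + R) := by
    rw [closedLoop_transpose A hS.isSymm hK.isSymm, ← neg_eq_iff_eq_neg.2 h, riccati]
    noncomm_ring
  have hpd : (-((A - S * K)ᵀ * K + K * (A - S * K))).PosDef :=
    e ▸ hQ.add_posSemidef ((hS.symm_mul_mul hK.isSymm).add hR)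
  -- `K` itself is the Lyapunov function: its Lyapunov form vanishes on its kernel, so that kernel
  -- is trivial.
  refine ⟨K, posDef_of_forall_mulVec_ne_zero hK fun v hv => ?_, hpd⟩
  by_contra hv0
  have := (posDef_iff_isSymm.1 hpd).2 v hv0
  rw [neg_mulVec, dotProduct_neg, dotProduct_lyapunov hK.isSymm, hv, zero_dotProduct] at this
  simp at this

/-- A stabilizing solution dominates all solutions with a smaller constant term. -/
theorem riccati_comparison {A S Q Q' K L : Matrix ι ι ℝ} (hS : S.PosSemidef) (hK : K.IsSymm)
    (hL : L.IsSymm) (hst : LyapunovStable (A - S * K)) (hQ : (Q - Q').PosSemidef)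
    (h : riccati A S Q K = 0) (h' : riccati A S Q' L = 0) : (K - L).PosSemidef := by
  refine hst.posSemidef (hK.sub hL) ?_
  have e : -((A - S * K)ᵀ * (K - L) + (K - L) * (A - S * K)) =
      (Q - Q') + (K - L) * S * (K - L) - (riccati A S Q K - riccati A S Q' L) := by
    rw [closedLoop_transpose A hS.isSymm hK, riccati, riccati]
    noncomm_ring
  rw [e, h, h', sub_zero, sub_zero]
  exact hQ.add (hS.symm_mul_mul (hK.sub hL))

/-- One step of Newton's method for the Riccati equation. -/
theorem exists_newton_step {A S Q H : Matrix ι ι ℝ} (hS : S.PosSemidef) (hQ : Q.PosSemidef)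
    (hH : H.IsSymm) (hst : LyapunovStable (A - S * H)) :
    ∃ K : Matrix ι ι ℝ, K.PosSemidef ∧
      (A - S * H)ᵀ * K + K * (A - S * H) + (Q + H * S * H) = 0 ∧
      (-riccati A S Q K).PosSemidef := by
  obtain ⟨K, hK, hKe⟩ := hst.exists_solution (hQ.add (hS.symm_mul_mul hH))
  refine ⟨K, hK, hKe, ?_⟩
  have e : -riccati A S Q K = (H - K) * S * (H - K) -
      ((A - S * H)ᵀ * K + K * (A - S * H) + (Q + H * S * H)) := by
    rw [closedLoop_transpose A hS.isSymm hH, riccati]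
    noncomm_ring
  rw [e, hKe, sub_zero]
  exact hS.symm_mul_mul (hH.sub hK.isSymm)

theorem isClosed_posSemidef : IsClosed {K : Matrix ι ι ℝ | K.PosSemidef} := by
  have : {K : Matrix ι ι ℝ | K.PosSemidef} =
      {K | Kᵀ = K} ∩ ⋂ v : ι → ℝ, {K | 0 ≤ v ⬝ᵥ (K *ᵥ v)} := by
    ext K
    simp [posSemidef_iff_isSymm, IsSymm]
  rw [this]
  exact (isClosed_eq (by fun_prop) (by fun_prop)).inter
    (isClosed_iInter fun v => isClosed_le (by fun_prop) (by fun_prop))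

/-- Testing on `eᵢ ± eⱼ` bounds twice the entry by the sum of two diagonal entries. -/
theorem abs_apply_le_trace {K : Matrix ι ι ℝ} (hK : K.PosSemidef) (i j : ι) :
    |K i j| ≤ K.trace := by
  classical
  obtain ⟨hs, hq⟩ := posSemidef_iff_isSymm.1 hK
  have hle : ∀ i, K i i ≤ K.trace := fun i =>
    Finset.single_le_sum (f := fun i => K i i) (fun i _ => hK.diag_nonneg) (Finset.mem_univ i)
  have h1 := hq (Pi.single i 1 + Pi.single j 1)
  have h2 := hq (Pi.single i 1 - Pi.single j 1)
  have hij := hs.apply i j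
  simp only [mulVec_add, mulVec_sub, add_dotProduct, sub_dotProduct, mulVec_single_one,
    dotProduct_add, dotProduct_sub, single_one_dotProduct, col_apply] at h1 h2
  rw [abs_le]
  constructor <;> linarith [hle i, hle j]

theorem isCompact_posSemidef_trace_le (c : ℝ) :
    IsCompact {K : Matrix ι ι ℝ | K.PosSemidef ∧ K.trace ≤ c} := by
  have hc : IsCompact (Set.univ.pi fun _ : ι => Set.univ.pi fun _ : ι => Set.Icc (-c) c) :=
    isCompact_univ_pi fun _ => isCompact_univ_pi fun _ => isCompact_Icc
  refine IsCompact.of_isClosed_subset (X := Matrix ι ι ℝ) hc ?_ ?_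
  · exact isClosed_posSemidef.inter (isClosed_le continuous_id.matrix_trace continuous_const)
  · intro K hK i _ j _
    exact abs_le.1 ((abs_apply_le_trace hK.1 i j).trans hK.2)

theorem continuous_riccati (A S Q : Matrix ι ι ℝ) : Continuous (riccati A S Q) := by
  unfold riccati
  fun_prop

theorem trace_eq_zero_of_posSemidef {K : Matrix ι ι ℝ} (hK : K.PosSemidef) (h : K.trace ≤ 0) :
    K = 0 := by
  ext i j
  simpa using (abs_apply_le_trace hK i j).trans h

/-- For a positive definite constant term and a stabilizable pair, the Riccati equation has a
stabilizing solution. -/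
theorem exists_stabilizing_riccati {A S Q H : Matrix ι ι ℝ} (hS : S.PosSemidef) (hQ : Q.PosDef)
    (hH : H.IsSymm) (hst : LyapunovStable (A - S * H)) :
    ∃ K : Matrix ι ι ℝ, K.PosSemidef ∧ riccati A S Q K = 0 ∧ LyapunovStable (A - S * K) := by
  obtain ⟨K₀, hK₀, -, hr₀⟩ := exists_newton_step hS hQ.posSemidef hH hst
  -- Instead of iterating Newton's method, minimize the trace over a compact set that is stable
  -- under Newton steps. A step decreases the matrix, so the minimizer is a fixed point, and a fixed
  -- point solves the Riccati equation.
  have hcomp : IsCompact ({K : Matrix ι ι ℝ | K.PosSemidef ∧ K.trace ≤ K₀.trace} ∩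
      {K | (-riccati A S Q K).PosSemidef}) :=
    (isCompact_posSemidef_trace_le _).inter_right
      (isClosed_posSemidef.preimage (continuous_riccati A S Q).neg)
  obtain ⟨K, ⟨⟨hK, hKt⟩, hr⟩, hmin⟩ := hcomp.exists_isMinOn ⟨K₀, ⟨hK₀, le_rfl⟩, hr₀⟩
    (f := trace) (by fun_prop)
  have hKst : LyapunovStable (A - S * K) :=
    lyapunovStable_closedLoop hS hQ hK hr (neg_neg _).symm
  obtain ⟨K', hK', hKe', hr'⟩ := exists_newton_step hS hQ.posSemidef hK.isSymm hKst
  have e : -((A - S * K)ᵀ * (K - K') + (K - K') * (A - S * K)) =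
      -riccati A S Q K + ((A - S * K)ᵀ * K' + K' * (A - S * K) + (Q + K * S * K)) := by
    rw [closedLoop_transpose A hS.isSymm hK.isSymm, riccati]
    noncomm_ring
  have hd : (K - K').PosSemidef := by
    refine hKst.posSemidef (hK.isSymm.sub hK'.isSymm) ?_
    rw [e, hKe', add_zero]
    exact hr
  have htr : K'.trace ≤ K.trace := by
    have := hd.trace_nonneg
    rwa [trace_sub, sub_nonneg] at this
  have hKK' : K - K' = 0 := by
    refine trace_eq_zero_of_posSemidef hd ?_
    rw [trace_sub, sub_nonpos]
    exact hmin ⟨⟨hK', htr.trans hKt⟩, hr'⟩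
  refine ⟨K, hK, ?_, hKst⟩
  rw [hKK', hKe'] at e
  simpa using e.symm

end Riccati

/-! ### Complex eigenvalues in real terms, and limits of spectra. -/

section Spectrum

theorem eq_zero_iff_re_im {ι : Type*} {x : ι → ℂ} :
    x = 0 ↔ (fun i => (x i).re) = 0 ∧ (fun i => (x i).im) = 0 := by
  simp only [funext_iff, Complex.ext_iff, ← forall_and]
  rfl

variable {ι : Type*} [Fintype ι]

theorem re_map_mulVec {κ : Type*} (M : Matrix κ ι ℝ) (x : ι → ℂ) (i : κ) :
    ((M.map (algebraMap ℝ ℂ) *ᵥ x) i).re = (M *ᵥ fun j => (x j).re) i := by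
  simp [mulVec, dotProduct]

theorem im_map_mulVec {κ : Type*} (M : Matrix κ ι ℝ) (x : ι → ℂ) (i : κ) :
    ((M.map (algebraMap ℝ ℂ) *ᵥ x) i).im = (M *ᵥ fun j => (x j).im) i := by
  simp [mulVec, dotProduct]

/-- `u + i w` satisfies `M (u + i w) = s (u + i w)`, in real terms. -/
def IsEigenPair (M : Matrix ι ι ℝ) (s : ℂ) (u w : ι → ℝ) : Prop :=
  M *ᵥ u = s.re • u - s.im • w ∧ M *ᵥ w = s.im • u + s.re • w

theorem map_mulVec_eq_smul_iff {M : Matrix ι ι ℝ} {s : ℂ} {x : ι → ℂ} :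
    M.map (algebraMap ℝ ℂ) *ᵥ x = s • x ↔
      IsEigenPair M s (fun i => (x i).re) (fun i => (x i).im) := by
  rw [IsEigenPair, funext_iff, funext_iff, funext_iff, ← forall_and]
  refine forall_congr' fun i => ?_
  rw [Complex.ext_iff, re_map_mulVec, im_map_mulVec]
  simp [add_comm]

theorem map_mulVec_eq_zero_iff {κ : Type*} {M : Matrix κ ι ℝ} {x : ι → ℂ} :
    M.map (algebraMap ℝ ℂ) *ᵥ x = 0 ↔
      (M *ᵥ fun i => (x i).re) = 0 ∧ (M *ᵥ fun i => (x i).im) = 0 := by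
  rw [funext_iff, funext_iff, funext_iff, ← forall_and]
  refine forall_congr' fun i => ?_
  rw [Complex.ext_iff, re_map_mulVec, im_map_mulVec]
  rfl

variable [DecidableEq ι]

theorem mem_spectrum_iff_exists_mulVec {M : Matrix ι ι ℂ} {s : ℂ} :
    s ∈ spectrum ℂ M ↔ ∃ x, x ≠ 0 ∧ M *ᵥ x = s • x := by
  rw [← spectrum_toLin', ← Module.End.hasEigenvalue_iff_mem_spectrum]
  constructor
  · intro h
    obtain ⟨x, hx⟩ := h.exists_hasEigenvector
    exact ⟨x, hx.2, by simpa using hx.apply_eq_smul⟩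
  · rintro ⟨x, hx, h⟩
    exact Module.End.hasEigenvalue_of_hasEigenvector
      (Module.End.hasEigenvector_iff.2 ⟨Module.End.mem_eigenspace_iff.2 (by simpa using h), hx⟩)

/-- Adding the Lyapunov forms at the real and imaginary parts of an eigenvector cancels the terms in
`s.im` and leaves `s.re` times a nonnegative number. -/
theorem LyapunovStable.re_neg {M : Matrix ι ι ℝ} (hM : LyapunovStable M) {s : ℂ}
    (hs : s ∈ spectrum ℂ (M.map (algebraMap ℝ ℂ))) : s.re < 0 := by
  obtain ⟨P, hP, hPM⟩ := hM
  obtain ⟨x, hx, hMx⟩ := mem_spectrum_iff_exists_mulVec.1 hs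
  obtain ⟨h1, h2⟩ := map_mulVec_eq_smul_iff.1 hMx
  rw [ne_eq, eq_zero_iff_re_im] at hx
  set u : ι → ℝ := fun i => (x i).re
  set w : ι → ℝ := fun i => (x i).im
  have key : (P *ᵥ u) ⬝ᵥ (M *ᵥ u) + (P *ᵥ w) ⬝ᵥ (M *ᵥ w) =
      s.re * (u ⬝ᵥ (P *ᵥ u) + w ⬝ᵥ (P *ᵥ w)) := by
    rw [h1, h2]
    simp only [dotProduct_sub, dotProduct_add, dotProduct_smul, smul_eq_mul]
    rw [dotProduct_comm (P *ᵥ u) w, hP.posSemidef.isSymm.dotProduct_mulVec_comm w u,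
      dotProduct_comm u, dotProduct_comm w]
    ring
  have hd := fun v => dotProduct_lyapunov hP.posSemidef.isSymm M v
  have hpos : ∀ v : ι → ℝ, 0 ≤ v ⬝ᵥ (P *ᵥ v) := (posSemidef_iff_isSymm.1 hP.posSemidef).2
  have hneg : ∀ v : ι → ℝ, (P *ᵥ v) ⬝ᵥ (M *ᵥ v) ≤ 0 := fun v => by
    have := (posSemidef_iff_isSymm.1 hPM.posSemidef).2 v
    rw [neg_mulVec, dotProduct_neg, hd] at this
    linarith
  have hneg' : ∀ v : ι → ℝ, v ≠ 0 → (P *ᵥ v) ⬝ᵥ (M *ᵥ v) < 0 := fun v hv => by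
    have := (posDef_iff_isSymm.1 hPM).2 v hv
    rw [neg_mulVec, dotProduct_neg, hd] at this
    linarith
  have hlt : (P *ᵥ u) ⬝ᵥ (M *ᵥ u) + (P *ᵥ w) ⬝ᵥ (M *ᵥ w) < 0 := by
    by_cases hu : u = 0
    · have := hneg' w fun hw => hx ⟨hu, hw⟩
      linarith [hneg u]
    · linarith [hneg' u hu, hneg w]
  rw [key] at hlt
  exact neg_of_mul_neg_left hlt (add_nonneg (hpos u) (hpos w))

theorem pow_card_le_norm_prod_sub {c : ℝ} (hc : 0 ≤ c) (z : ℂ) (t : Multiset ℂ)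
    (h : ∀ r ∈ t, c ≤ ‖z - r‖) : c ^ t.card ≤ ‖(t.map fun r => z - r).prod‖ := by
  induction t using Multiset.induction with
  | empty => simp
  | cons a t ih =>
    rw [Multiset.card_cons, Multiset.map_cons, Multiset.prod_cons, norm_mul, pow_succ']
    exact mul_le_mul (h a (Multiset.mem_cons_self a t))
      (ih fun r hr => h r (Multiset.mem_cons_of_mem hr)) (by positivity) (norm_nonneg _)

/-- The closed left half plane is closed under limits of spectra. -/
theorem re_nonpos_of_tendsto {M : ℕ → Matrix ι ι ℝ} {M' : Matrix ι ι ℝ}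
    (hlim : Tendsto M atTop (𝓝 M'))
    (hM : ∀ k, ∀ s ∈ spectrum ℂ ((M k).map (algebraMap ℝ ℂ)), s.re ≤ 0) {s : ℂ}
    (hs : s ∈ spectrum ℂ (M'.map (algebraMap ℝ ℂ))) : s.re ≤ 0 := by
  by_contra! hpos
  -- All roots of the characteristic polynomial of `M k` are at distance at least `s.re` from `s`;
  -- this bound survives in the limit, where the determinant is zero.
  have hbound : ∀ k, s.re ^ Fintype.card ι ≤ ‖(scalar ι s - (M k).map (algebraMap ℝ ℂ)).det‖ := by
    intro k
    have hsp := IsAlgClosed.splits ((M k).map (algebraMap ℝ ℂ)).charpoly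
    rw [← eval_charpoly, hsp.eval_eq_prod_roots_of_monic (charpoly_monic _),
      ← charpoly_natDegree_eq_dim ((M k).map (algebraMap ℝ ℂ)), hsp.natDegree_eq_card_roots]
    refine pow_card_le_norm_prod_sub hpos.le s _ fun r hr => ?_
    have hr' := hM k r (mem_spectrum_iff_isRoot_charpoly.2 (Polynomial.isRoot_of_mem_roots hr))
    calc s.re ≤ (s - r).re := by rw [Complex.sub_re]; linarith
      _ ≤ ‖s - r‖ := Complex.re_le_norm _
  have hcont : Continuous fun N : Matrix ι ι ℝ =>
      ‖(scalar ι s - N.map (algebraMap ℝ ℂ)).det‖ := by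
    have : Continuous fun N : Matrix ι ι ℝ => N.map (algebraMap ℝ ℂ) :=
      continuous_id.matrix_map Complex.continuous_ofReal
    exact ((continuous_const.sub this).matrix_det).norm
  have hle := ge_of_tendsto' ((hcont.tendsto M').comp hlim) hbound
  have h0 : (scalar ι s - M'.map (algebraMap ℝ ℂ)).det = 0 := by
    rw [← eval_charpoly]
    exact mem_spectrum_iff_isRoot_charpoly.1 hs
  rw [h0, norm_zero] at hle
  exact absurd hle (not_le.2 (by positivity))

end Spectrum

/-! ### The maximal solution for semidefinite `Q`. -/

section Extremal

variable {ι : Type*} [Fintype ι] [DecidableEq ι]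

/-- A Riccati equation with positive semidefinite constant term over a stabilizable pair has a
maximal solution, and its closed loop has no eigenvalue in the open right half plane. -/
theorem exists_maximal_riccati {A S Q H : Matrix ι ι ℝ} (hS : S.PosSemidef) (hQ : Q.PosSemidef)
    (hH : H.IsSymm) (hst : LyapunovStable (A - S * H)) :
    ∃ K : Matrix ι ι ℝ, K.PosSemidef ∧ riccati A S Q K = 0 ∧
      (∀ L : Matrix ι ι ℝ, L.IsSymm → riccati A S Q L = 0 → (K - L).PosSemidef) ∧
      ∀ s ∈ spectrum ℂ ((A - S * K).map (algebraMap ℝ ℂ)), s.re ≤ 0 := by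
  set ε : ℕ → ℝ := fun k => 1 / ((k : ℝ) + 1) with hε
  have hε0 : ∀ k, 0 < ε k := fun k => Nat.one_div_pos_of_nat
  have hε1 : ∀ k, ε k ≤ 1 := fun k => by
    simp only [hε]
    rw [div_le_one (by positivity)]
    linarith [(Nat.cast_nonneg k : (0 : ℝ) ≤ k)]
  choose K hK hKe hKst using fun k => exists_stabilizing_riccati hS
    ((PosDef.one.smul (hε0 k)).posSemidef_add hQ) hH hst
  -- `ε 0 = 1` is the largest perturbation, so `K 0` dominates the sequence and bounds its traces.
  have hdom : ∀ k, (K 0 - K k).PosSemidef := fun k => by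
    refine riccati_comparison hS (hK 0).isSymm (hK k).isSymm (hKst 0) ?_ (hKe 0) (hKe k)
    rw [add_sub_add_left_eq_sub, ← sub_smul]
    exact PosSemidef.one.smul (a := ε 0 - ε k) (by simpa [hε] using hε1 k)
  have : FirstCountableTopology (Matrix ι ι ℝ) :=
    inferInstanceAs (FirstCountableTopology (ι → ι → ℝ))
  obtain ⟨K', hK', φ, hφ, hlim⟩ := (isCompact_posSemidef_trace_le (K 0).trace).tendsto_subseq
    (x := K) fun k => ⟨hK k, by simpa using (hdom k).trace_nonneg⟩
  refine ⟨K', hK'.1, ?_, fun L hL hLe => ?_, fun s hs => ?_⟩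
  · have h1 : Tendsto (fun k => riccati A S Q (K (φ k)) + ε (φ k) • (1 : Matrix ι ι ℝ)) atTop
        (𝓝 (riccati A S Q K' + (0 : ℝ) • (1 : Matrix ι ι ℝ))) :=
      (((continuous_riccati A S Q).tendsto K').comp hlim).add
        ((tendsto_one_div_add_atTop_nhds_zero_nat.comp hφ.tendsto_atTop).smul_const _)
    have h2 : (fun k => riccati A S Q (K (φ k)) + ε (φ k) • (1 : Matrix ι ι ℝ)) = fun _ => 0 := by
      funext k
      rw [← hKe (φ k), riccati, riccati]
      abel
    rw [h2, zero_smul, add_zero] at h1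
    exact (tendsto_nhds_unique h1 tendsto_const_nhds)
  · refine isClosed_posSemidef.mem_of_tendsto (hlim.sub_const L) (Eventually.of_forall fun k => ?_)
    refine riccati_comparison hS (hK _).isSymm hL (hKst _) ?_ (hKe _) hLe
    rw [add_sub_cancel_left]
    exact PosSemidef.one.smul (hε0 _).le
  · refine re_nonpos_of_tendsto (M := fun k => A - S * K (φ k)) ?_
      (fun k s hs => ((hKst (φ k)).re_neg hs).le) hs
    exact (Continuous.tendsto (by fun_prop : Continuous fun N : Matrix ι ι ℝ => A - S * N) K').comp
      hlim

end Extremal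

/-! ### Controllability and stabilizing feedback. -/

section Controllable

variable {ι : Type*} [Fintype ι] [DecidableEq ι]

theorem exists_add_smul_one_posDef {N : Matrix ι ι ℝ} (hN : N.IsSymm) :
    ∃ c : ℝ, 0 < c ∧ (N + c • (1 : Matrix ι ι ℝ)).PosDef := by
  refine ⟨∑ i, ∑ j, |N i j| + 1, by positivity,
    posDef_iff_isSymm.2 ⟨hN.add (isSymm_one.smul _), fun v hv => ?_⟩⟩
  have hvv : 0 < v ⬝ᵥ v := by
    simpa using dotProduct_star_self_pos_iff.2 hv
  have hle : ∀ i, v i ^ 2 ≤ v ⬝ᵥ v := fun i => by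
    rw [sq]
    exact Finset.single_le_sum (f := fun i => v i * v i) (fun i _ => mul_self_nonneg _)
      (Finset.mem_univ i)
  have hterm : ∀ i j, -(|N i j| * (v ⬝ᵥ v)) ≤ v i * (N i j * v j) := fun i j => by
    have h1 : |v i * v j| ≤ v ⬝ᵥ v := by
      rw [abs_le]
      constructor <;> nlinarith [hle i, hle j, sq_nonneg (v i + v j), sq_nonneg (v i - v j)]
    have h2 : |v i * (N i j * v j)| ≤ |N i j| * (v ⬝ᵥ v) := by
      rw [show v i * (N i j * v j) = N i j * (v i * v j) by ring, abs_mul]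
      exact mul_le_mul_of_nonneg_left h1 (abs_nonneg _)
    exact (abs_le.1 h2).1
  have hsum : -((∑ i, ∑ j, |N i j|) * (v ⬝ᵥ v)) ≤ v ⬝ᵥ (N *ᵥ v) := by
    have e : v ⬝ᵥ (N *ᵥ v) = ∑ i, ∑ j, v i * (N i j * v j) := by
      simp [dotProduct, mulVec, Finset.mul_sum]
    rw [e, Finset.sum_mul, ← Finset.sum_neg_distrib]
    refine Finset.sum_le_sum fun i _ => ?_
    rw [Finset.sum_mul, ← Finset.sum_neg_distrib]
    exact Finset.sum_le_sum fun j _ => hterm i j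
  rw [add_mulVec, smul_mulVec, one_mulVec, dotProduct_add, dotProduct_smul, smul_eq_mul]
  linarith

/-- The pair `(A, S)` is controllable: no nonzero covector annihilates all `A ^ k S`. -/
def Controllable (A S : Matrix ι ι ℝ) : Prop :=
  ∀ v : ι → ℝ, (∀ k : ℕ, S *ᵥ ((Aᵀ ^ k) *ᵥ v) = 0) → v = 0

theorem Controllable.neg {A S : Matrix ι ι ℝ} (h : Controllable A S) : Controllable (-A) S := by
  refine fun v hv => h v fun k => ?_
  have := hv k
  rw [transpose_neg, neg_pow, ← mulVec_mulVec] at this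
  rcases neg_one_pow_eq_or (Matrix ι ι ℝ) k with h1 | h1 <;> rw [h1] at this
  · simpa using this
  · simpa [neg_mulVec, mulVec_neg] using this

/-- Bass' construction of a stabilizing feedback. -/
theorem Controllable.exists_stabilizing {A S : Matrix ι ι ℝ} (hc : Controllable A S)
    (hS : S.PosSemidef) : ∃ H : Matrix ι ι ℝ, H.IsSymm ∧ LyapunovStable (A - S * H) := by
  -- With this `β` the identity is a Lyapunov function for `-(A + β I)ᵀ`.
  obtain ⟨β, hβ, hpd⟩ : ∃ β : ℝ, 0 < β ∧ (A + Aᵀ + (2 * β) • (1 : Matrix ι ι ℝ)).PosDef := by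
    obtain ⟨c, hc0, hcpd⟩ := exists_add_smul_one_posDef (isSymm_add_transpose_self A)
    exact ⟨c / 2, by positivity, by rwa [mul_div_cancel₀ c two_ne_zero]⟩
  set M : Matrix ι ι ℝ := -(A + β • (1 : Matrix ι ι ℝ))ᵀ with hM
  have hMst : LyapunovStable M := by
    refine ⟨1, PosDef.one, ?_⟩
    convert hpd using 1
    simp only [hM, transpose_neg, transpose_transpose, mul_one, one_mul, transpose_add,
      transpose_smul, transpose_one, two_mul, add_smul]
    abel
  -- The constant term is `2 S` because `S` enters the Lyapunov form of `A - S Z⁻¹` twice; what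
  -- remains there is exactly `-2β Z⁻¹`.
  obtain ⟨Z, hZ, hZe⟩ := hMst.exists_solution (hS.add hS)
  have hZe' : A * Z + Z * Aᵀ + (2 * β) • Z = S + S := by
    rw [← sub_eq_zero, ← neg_eq_zero, ← hZe]
    simp only [hM, transpose_neg, transpose_transpose, transpose_add, transpose_smul,
      transpose_one, two_mul, add_smul, neg_mul, mul_neg, add_mul, mul_add, smul_mul_assoc,
      mul_smul_comm, one_mul, mul_one]
    abel
  -- The kernel of `Z` is `Aᵀ`-invariant and contained in that of `S`, so controllability makes it
  -- trivial.
  have hstep : ∀ v, Z *ᵥ v = 0 → S *ᵥ v = 0 ∧ Z *ᵥ (Aᵀ *ᵥ v) = 0 := fun v hv => by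
    have h1 := congrArg (· *ᵥ v) hZe'
    simp only [add_mulVec, smul_mulVec, ← mulVec_mulVec, hv, mulVec_zero, smul_zero, add_zero,
      zero_add] at h1
    have h2 : S *ᵥ v = 0 := by
      refine hS.mulVec_eq_zero ?_
      have h3 := congrArg (v ⬝ᵥ ·) h1
      simp only [hZ.isSymm.dotProduct_mulVec_comm, hv, zero_dotProduct, dotProduct_add] at h3
      linarith
    exact ⟨h2, by rw [h1, h2, add_zero]⟩
  have hZpd : Z.PosDef := by
    refine posDef_of_forall_mulVec_ne_zero hZ fun v hv => hc v fun k => ?_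
    have : ∀ k, Z *ᵥ ((Aᵀ ^ k) *ᵥ v) = 0 := fun k => by
      induction k with
      | zero => simpa using hv
      | succ k ih => rw [pow_succ', ← mulVec_mulVec]; exact (hstep _ ih).2
    exact (hstep _ (this k)).1
  have hdet : IsUnit Z.det := (isUnit_iff_isUnit_det Z).1 hZpd.isUnit
  have hP := hZpd.inv
  refine ⟨Z⁻¹, hP.posSemidef.isSymm, Z⁻¹, hP, ?_⟩
  have e : -((A - S * Z⁻¹)ᵀ * Z⁻¹ + Z⁻¹ * (A - S * Z⁻¹)) = (2 * β) • Z⁻¹ := by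
    rw [closedLoop_transpose A hS.isSymm hP.posSemidef.isSymm]
    have h1 : Z⁻¹ * (A * Z + Z * Aᵀ + (2 * β) • Z) * Z⁻¹ = Z⁻¹ * (S + S) * Z⁻¹ := by rw [hZe']
    have h2 : Z⁻¹ * (A * Z + Z * Aᵀ + (2 * β) • Z) * Z⁻¹ =
        Z⁻¹ * A * (Z * Z⁻¹) + (Z⁻¹ * Z) * Aᵀ * Z⁻¹ + (2 * β) • ((Z⁻¹ * Z) * Z⁻¹) := by
      simp only [mul_add, add_mul, mul_smul_comm, smul_mul_assoc, mul_assoc]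
    rw [h2, mul_nonsing_inv _ hdet, nonsing_inv_mul _ hdet, mul_one, one_mul, one_mul] at h1
    rw [← sub_eq_iff_eq_add'.2 h1.symm]
    noncomm_ring
  rw [e]
  exact hP.smul (by positivity)

end Controllable

/-! ### The gap between the extremal solutions. -/

section ExtremalGap

variable {ι : Type*} [Fintype ι]

/-- Negation reverses the order, so minimal solutions for `A` come from maximal ones for `-A`. -/
theorem riccati_neg (A S Q K : Matrix ι ι ℝ) : riccati (-A) S Q (-K) = riccati A S Q K := by
  rw [riccati, riccati, transpose_neg]
  noncomm_ring

/-- A purely imaginary eigenpair annihilates the Lyapunov form. -/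
theorem IsEigenPair.lyapunov_eq_zero {M X : Matrix ι ι ℝ} {s : ℂ} {u w : ι → ℝ}
    (h : IsEigenPair M s u w) (hs : s.re = 0) (hX : X.IsSymm) :
    u ⬝ᵥ ((Mᵀ * X + X * M) *ᵥ u) + w ⬝ᵥ ((Mᵀ * X + X * M) *ᵥ w) = 0 := by
  rw [dotProduct_lyapunov hX, dotProduct_lyapunov hX, h.1, h.2, hs]
  simp only [zero_smul, zero_sub, add_zero, dotProduct_neg, dotProduct_smul, smul_eq_mul]
  rw [dotProduct_comm _ w, hX.dotProduct_mulVec_comm w u]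
  ring

/-- No purely imaginary eigenvector of `A` lies in the kernel of `Q`. -/
def ImaginaryObservable (A Q : Matrix ι ι ℝ) : Prop :=
  ∀ (s : ℂ) (u w : ι → ℝ), s.re = 0 → IsEigenPair A s u w → Q *ᵥ u = 0 → Q *ᵥ w = 0 →
    u = 0 ∧ w = 0

variable [DecidableEq ι]

/-- Every solution of the Riccati equation annihilates the unobservable imaginary eigenvectors. -/
theorem riccati_solution_mulVec_eq_zero {A S Q K : Matrix ι ι ℝ} (hc : Controllable A S)
    (hS : S.PosSemidef) (hK : K.IsSymm) (hKe : riccati A S Q K = 0) {s : ℂ} {u w : ι → ℝ}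
    (hs : s.re = 0) (h : IsEigenPair A s u w) (hu : Q *ᵥ u = 0) (hw : Q *ᵥ w = 0) :
    K *ᵥ u = 0 ∧ K *ᵥ w = 0 := by
  have e : Aᵀ * K + K * A = K * S * K - Q := by
    rw [← sub_eq_zero, ← hKe, riccati]
    abel
  have hquad := (posSemidef_iff_isSymm.1 (hS.symm_mul_mul hK)).2
  have h0 := h.lyapunov_eq_zero hs hK
  rw [e] at h0
  simp only [sub_mulVec, hu, hw, sub_zero] at h0
  have hform : ∀ v, v ⬝ᵥ ((K * S * K) *ᵥ v) = (K *ᵥ v) ⬝ᵥ (S *ᵥ (K *ᵥ v)) := fun v => by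
    rw [← mulVec_mulVec, ← mulVec_mulVec, hK.dotProduct_mulVec_comm]
  have hSu : S *ᵥ (K *ᵥ u) = 0 := hS.mulVec_eq_zero (by
    rw [← hform]; linarith [hquad u, hquad w])
  have hSw : S *ᵥ (K *ᵥ w) = 0 := hS.mulVec_eq_zero (by
    rw [← hform]; linarith [hquad u, hquad w])
  have hAu : Aᵀ *ᵥ (K *ᵥ u) = s.im • (K *ᵥ w) := by
    have h1 := congrArg (· *ᵥ u) e
    simp only [add_mulVec, sub_mulVec, ← mulVec_mulVec, hSu, hu, h.1, hs, mulVec_zero, sub_zero,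
      zero_smul, zero_sub, mulVec_neg, mulVec_smul] at h1
    rwa [← sub_eq_zero, sub_eq_add_neg]
  have hAw : Aᵀ *ᵥ (K *ᵥ w) = -(s.im • (K *ᵥ u)) := by
    have h1 := congrArg (· *ᵥ w) e
    simp only [add_mulVec, sub_mulVec, ← mulVec_mulVec, hSw, hw, h.2, hs, mulVec_zero, sub_zero,
      zero_smul, add_zero, mulVec_smul] at h1
    rwa [← sub_eq_zero, sub_neg_eq_add]
  -- The span of `K u` and `K w` is `Aᵀ`-invariant and killed by `S`, so controllability applies to
  -- each of its vectors.
  have hspan : ∀ a b : ℝ, a • (K *ᵥ u) + b • (K *ᵥ w) = 0 := fun a b => by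
    refine hc _ fun k => ?_
    obtain ⟨a', b', hab⟩ : ∃ a' b' : ℝ, (Aᵀ ^ k) *ᵥ (a • (K *ᵥ u) + b • (K *ᵥ w)) =
        a' • (K *ᵥ u) + b' • (K *ᵥ w) := by
      induction k with
      | zero => exact ⟨a, b, by simp⟩
      | succ k ih =>
        obtain ⟨a', b', hab⟩ := ih
        refine ⟨-(b' * s.im), a' * s.im, ?_⟩
        rw [pow_succ', ← mulVec_mulVec, hab, mulVec_add, mulVec_smul, mulVec_smul, hAu, hAw]
        module
    rw [hab, mulVec_add, mulVec_smul, mulVec_smul, hSu, hSw, smul_zero, smul_zero, add_zero]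
  exact ⟨by simpa using hspan 1 0, by simpa using hspan 0 1⟩

/-- A singular gap between two ordered solutions produces a common eigenvector of the two closed
loops. -/
theorem exists_eigenvector_of_gap {A S Q K L : Matrix ι ι ℝ} (hS : S.IsSymm) (hK : K.IsSymm)
    (hKe : riccati A S Q K = 0) (hLe : riccati A S Q L = 0) {v : ι → ℝ}
    (hv : v ≠ 0) (hKL : (K - L) *ᵥ v = 0) :
    ∃ (s : ℂ) (x : ι → ℂ), x ≠ 0 ∧ (A - S * K).map (algebraMap ℝ ℂ) *ᵥ x = s • x ∧
      (K - L).map (algebraMap ℝ ℂ) *ᵥ x = 0 := by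
  -- The difference of the two Riccati equations, factored so that the kernel of `K - L` is visibly
  -- invariant under `A - S K`.
  have e : (K - L) * (A - S * K) = -((A - S * K)ᵀ + (K - L) * S) * (K - L) := by
    rw [← sub_eq_zero]
    refine Eq.trans ?_ (sub_eq_zero.2 (hKe.trans hLe.symm))
    rw [closedLoop_transpose A hS hK, riccati, riccati]
    noncomm_ring
  have e' := congrArg (fun N => N.map (algebraMap ℝ ℂ)) e
  simp only [Matrix.map_mul] at e'
  set Δ := (K - L).map (algebraMap ℝ ℂ) with hΔ
  set M := (A - S * K).map (algebraMap ℝ ℂ) with hM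
  let V : Submodule ℂ (ι → ℂ) := LinearMap.ker Δ.mulVecLin
  have hmem : ∀ x, x ∈ V ↔ Δ *ᵥ x = 0 := fun x => Iff.rfl
  have hinv : ∀ x ∈ V, M.mulVecLin x ∈ V := fun x hx => by
    rw [hmem] at hx ⊢
    rw [mulVecLin_apply, mulVec_mulVec, e', ← mulVec_mulVec, hx, mulVec_zero]
  have hV : Nontrivial V := by
    refine ⟨⟨⟨fun i => (v i : ℂ), ?_⟩, 0, ?_⟩⟩
    · rw [hmem, map_mulVec_eq_zero_iff]
      exact ⟨hKL, by exact mulVec_zero (K - L)⟩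
    · intro h
      refine hv (funext fun i => ?_)
      have := congrFun (congrArg Subtype.val h) i
      simpa using this
  obtain ⟨s, hs⟩ := Module.End.exists_eigenvalue (M.mulVecLin.restrict hinv)
  obtain ⟨x, hx⟩ := hs.exists_hasEigenvector
  refine ⟨s, x.1, fun h => hx.2 (Subtype.ext h), ?_, x.2⟩
  exact congrArg Subtype.val hx.apply_eq_smul

/-- Over a controllable pair with `Q ≥ 0`, the Riccati equation has extremal solutions, and their
gap is positive definite iff the imaginary eigenvalues are observable. -/
theorem exists_extremal_riccati {A S Q : Matrix ι ι ℝ} (hc : Controllable A S)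
    (hS : S.PosSemidef) (hQ : Q.PosSemidef) :
    ∃ K L : Matrix ι ι ℝ, K.IsSymm ∧ L.IsSymm ∧ riccati A S Q K = 0 ∧ riccati A S Q L = 0 ∧
      (∀ X : Matrix ι ι ℝ, X.IsSymm → riccati A S Q X = 0 → (K - X).PosSemidef) ∧
      (∀ X : Matrix ι ι ℝ, X.IsSymm → riccati A S Q X = 0 → (X - L).PosSemidef) ∧
      (ImaginaryObservable A Q ↔ (K - L).PosDef) := by
  obtain ⟨H, hH, hst⟩ := hc.exists_stabilizing hS
  obtain ⟨K, hK, hKe, hKmax, hKspec⟩ := exists_maximal_riccati hS hQ hH hst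
  obtain ⟨H', hH', hst'⟩ := hc.neg.exists_stabilizing hS
  obtain ⟨L', hL', hLe', hLmax', hLspec'⟩ := exists_maximal_riccati hS hQ hH' hst'
  have hLs : (-L').IsSymm := hL'.isSymm.neg
  have hLe : riccati A S Q (-L') = 0 := by rw [← riccati_neg, neg_neg, hLe']
  refine ⟨K, -L', hK.isSymm, hLs, hKe, hLe, hKmax, fun X hX hXe => ?_, fun hobs => ?_,
    fun hpd s u w hs h hu hw => ?_⟩
  · have := hLmax' (-X) hX.neg (by rw [riccati_neg, hXe])
    rwa [sub_neg_eq_add, add_comm, ← sub_neg_eq_add] at this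
  · refine posDef_of_forall_mulVec_ne_zero (hKmax _ hLs hLe) fun v hv => ?_
    by_contra hv0
    obtain ⟨s, x, hx, hKx, hΔx⟩ :=
      exists_eigenvector_of_gap hS.isSymm hK.isSymm hKe hLe hv0 hv
    have h1 : s.re ≤ 0 := hKspec s (mem_spectrum_iff_exists_mulVec.2 ⟨x, hx, hKx⟩)
    have h2 : (-s).re ≤ 0 := by
      refine hLspec' (-s) (mem_spectrum_iff_exists_mulVec.2 ⟨x, hx, ?_⟩)
      -- On the kernel of the gap, the closed loop for `-A` is minus that of `K`, so `-s` is an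
      -- eigenvalue of it.
      have e : -A - S * L' = -(A - S * K) - S * (K - -L') := by noncomm_ring
      have e' := congrArg (fun N => N.map (algebraMap ℝ ℂ)) e
      simp only [Matrix.map_sub _ (map_sub (algebraMap ℝ ℂ)), Matrix.map_mul,
        Matrix.map_neg _ (map_neg (algebraMap ℝ ℂ))] at e' hKx hΔx ⊢
      rw [e', sub_mulVec, neg_mulVec, hKx, ← mulVec_mulVec, hΔx, mulVec_zero, sub_zero, neg_smul]
    have hs : s.re = 0 := le_antisymm h1 (by simpa using h2)
    have hp := map_mulVec_eq_smul_iff.1 hKx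
    rw [ne_eq, eq_zero_iff_re_im] at hx
    set u : ι → ℝ := fun i => (x i).re
    set w : ι → ℝ := fun i => (x i).im
    -- This zero is minus a sum of nonnegative forms of `Q` and `S`, each of which must vanish;
    -- hence the closed-loop eigenvector is one of `A`.
    have h0 := hp.lyapunov_eq_zero hs hK.isSymm
    have e : (A - S * K)ᵀ * K + K * (A - S * K) = -(Q + K * S * K) := by
      rw [← add_eq_zero_iff_eq_neg, closedLoop_transpose A hS.isSymm hK.isSymm, ← hKe, riccati]
      noncomm_ring
    have hq := (posSemidef_iff_isSymm.1 hQ).2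
    have hform : ∀ v, v ⬝ᵥ ((K * S * K) *ᵥ v) = (K *ᵥ v) ⬝ᵥ (S *ᵥ (K *ᵥ v)) := fun v => by
      rw [← mulVec_mulVec, ← mulVec_mulVec, hK.isSymm.dotProduct_mulVec_comm]
    have hSq := (posSemidef_iff_isSymm.1 hS).2
    rw [e] at h0
    simp only [neg_mulVec, add_mulVec, dotProduct_neg, dotProduct_add, hform] at h0
    have hSu : S *ᵥ (K *ᵥ u) = 0 := hS.mulVec_eq_zero (by
      linarith [hq u, hq w, hSq (K *ᵥ u), hSq (K *ᵥ w)])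
    have hSw : S *ᵥ (K *ᵥ w) = 0 := hS.mulVec_eq_zero (by
      linarith [hq u, hq w, hSq (K *ᵥ u), hSq (K *ᵥ w)])
    have hQu : Q *ᵥ u = 0 := hQ.mulVec_eq_zero (by
      linarith [hq u, hq w, hSq (K *ᵥ u), hSq (K *ᵥ w)])
    have hQw : Q *ᵥ w = 0 := hQ.mulVec_eq_zero (by
      linarith [hq u, hq w, hSq (K *ᵥ u), hSq (K *ᵥ w)])
    refine hx (hobs s u w hs ?_ hQu hQw)
    rw [IsEigenPair, sub_mulVec, sub_mulVec, ← mulVec_mulVec, ← mulVec_mulVec, hSu, hSw, sub_zero,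
      sub_zero] at hp
    exact hp
  · obtain ⟨hu1, hw1⟩ := riccati_solution_mulVec_eq_zero hc hS hK.isSymm hKe hs h hu hw
    obtain ⟨hu2, hw2⟩ := riccati_solution_mulVec_eq_zero hc hS hLs hLe hs h hu hw
    have hz : ∀ v, K *ᵥ v = 0 → (-L') *ᵥ v = 0 → v = 0 := fun v hv hv' => by
      by_contra hv0
      have := (posDef_iff_isSymm.1 hpd).2 v hv0
      rw [sub_mulVec, hv, hv', sub_zero, dotProduct_zero] at this
      exact lt_irrefl _ this
    exact ⟨hz u hu1 hu2, hz w hw1 hw2⟩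

end ExtremalGap

/-! ### The controllable subspace and the rank test. -/

section Controllability

variable {n m : ℕ}

/-- By Cayley–Hamilton, every power of `A` is a polynomial in `A` of degree below `n`. -/
theorem pow_mulVec_mem_controllableSubspace (A : Matrix (Fin n) (Fin n) ℝ)
    (B : Matrix (Fin n) (Fin m) ℝ) (k : ℕ) (y : Fin m → ℝ) :
    (A ^ k) *ᵥ (B *ᵥ y) ∈ controllableSubspace A B := by
  have hlt : ∀ i < n, (A ^ i) *ᵥ (B *ᵥ y) ∈ controllableSubspace A B := fun i hi =>
    Submodule.mem_iSup_of_mem (⟨i, hi⟩ : Fin n) ⟨B *ᵥ y, ⟨y, rfl⟩, rfl⟩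
  -- For `n = 0` the characteristic polynomial is `1`, and no remainder has degree strictly below
  -- `0`.
  rcases Nat.eq_zero_or_pos n with rfl | hn
  · rw [Subsingleton.elim ((A ^ k) *ᵥ (B *ᵥ y)) 0]
    exact zero_mem _
  have hdeg : (Polynomial.X ^ k %ₘ A.charpoly).natDegree < n := by
    have h1 : A.charpoly.natDegree = n := by simp
    have h2 := Polynomial.natDegree_modByMonic_lt (Polynomial.X ^ k) (charpoly_monic A)
      (fun h => by rw [h, Polynomial.natDegree_one] at h1; omega)
    omega
  rw [pow_eq_aeval_mod_charpoly, Polynomial.aeval_eq_sum_range' hdeg, sum_mulVec]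
  refine Submodule.sum_mem _ fun i hi => ?_
  rw [smul_mulVec]
  exact Submodule.smul_mem _ _ (hlt i (Finset.mem_range.1 hi))

theorem controllableSubspace_le {A : Matrix (Fin n) (Fin n) ℝ} {B : Matrix (Fin n) (Fin m) ℝ}
    {V : Submodule ℝ (Fin n → ℝ)} (h : ∀ k y, (A ^ k) *ᵥ (B *ᵥ y) ∈ V) :
    controllableSubspace A B ≤ V := by
  refine iSup_le fun i => ?_
  rintro _ ⟨_, ⟨y, rfl⟩, rfl⟩
  exact h i y

theorem mulVec_mem_controllableSubspace {A : Matrix (Fin n) (Fin n) ℝ}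
    {B : Matrix (Fin n) (Fin m) ℝ} {x : Fin n → ℝ} (hx : x ∈ controllableSubspace A B) :
    A *ᵥ x ∈ controllableSubspace A B := by
  have : controllableSubspace A B ≤ (controllableSubspace A B).comap A.mulVecLin :=
    controllableSubspace_le fun k y => by
      rw [Submodule.mem_comap, mulVecLin_apply, mulVec_mulVec, ← pow_succ']
      exact pow_mulVec_mem_controllableSubspace A B (k + 1) y
  exact this hx

theorem observableAt_iff {p : ℕ} {C : Matrix (Fin p) (Fin n) ℝ} {A : Matrix (Fin n) (Fin n) ℝ}
    {s : ℂ} : ObservableAt C A s ↔ ∀ x : Fin n → ℂ, A.map (algebraMap ℝ ℂ) *ᵥ x = s • x →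
      C.map (algebraMap ℝ ℂ) *ᵥ x = 0 → x = 0 := by
  set N := fromRows (A.map (algebraMap ℝ ℂ) - s • (1 : Matrix (Fin n) (Fin n) ℂ))
    (C.map (algebraMap ℝ ℂ)) with hN
  have h1 := N.mulVecLin.finrank_range_add_finrank_ker
  rw [Module.finrank_fin_fun] at h1
  have h2 : ObservableAt C A s ↔ LinearMap.ker N.mulVecLin = ⊥ := by
    rw [ObservableAt, ← hN, rank, ← Submodule.finrank_eq_zero]
    omega
  rw [h2, LinearMap.ker_eq_bot']
  refine forall_congr' fun x => ?_
  rw [mulVecLin_apply, hN, fromRows_mulVec, ← and_imp]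
  refine imp_congr_left ?_
  rw [← Sum.elim_zero_zero, Sum.elim_eq_iff, sub_mulVec, smul_mulVec, one_mulVec, sub_eq_zero]

theorem forall_observableAt_iff {A Q : Matrix (Fin n) (Fin n) ℝ} :
    (∀ s ∈ eigenvalues A, s.re = 0 → ObservableAt Q A s) ↔ ImaginaryObservable A Q := by
  constructor
  · intro h s u w hs hp hu hw
    have hx : A.map (algebraMap ℝ ℂ) *ᵥ (fun i => (⟨u i, w i⟩ : ℂ)) =
      s • (fun i => (⟨u i, w i⟩ : ℂ)) := map_mulVec_eq_smul_iff.2 hp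
    by_contra hne
    have hx0 : (fun i => (⟨u i, w i⟩ : ℂ)) ≠ 0 := fun h0 => hne (eq_zero_iff_re_im.1 h0)
    exact hx0 (observableAt_iff.1 (h s (mem_spectrum_iff_exists_mulVec.2 ⟨_, hx0, hx⟩) hs) _ hx
      (map_mulVec_eq_zero_iff.2 ⟨hu, hw⟩))
  · intro h s _ hs
    refine observableAt_iff.2 fun x hx hQx => ?_
    obtain ⟨hu, hw⟩ := map_mulVec_eq_zero_iff.1 hQx
    exact eq_zero_iff_re_im.2 (h s _ _ hs (map_mulVec_eq_smul_iff.1 hx) hu hw)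

end Controllability

/-! ### Reduction to the controllable block. -/

section Kalman

variable {n m n₁ n₂ : ℕ} (b : Module.Basis (Fin n₁ ⊕ Fin n₂) ℝ (Fin n → ℝ))

theorem basisMatrixInv_mul_basisMatrix : basisMatrixInv b * basisMatrix b = 1 :=
  Module.Basis.toMatrix_mul_toMatrix_flip _ _

theorem basisMatrix_mul_basisMatrixInv : basisMatrix b * basisMatrixInv b = 1 :=
  Module.Basis.toMatrix_mul_toMatrix_flip _ _

theorem basisMatrixInv_mulVec (x : Fin n → ℝ) : basisMatrixInv b *ᵥ x = b.repr x := by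
  rw [← Module.Basis.toMatrix_mulVec_repr (Pi.basisFun ℝ (Fin n)) b x]
  rfl

theorem basisMatrix_mulVec_inv (x : Fin n → ℝ) :
    basisMatrix b *ᵥ (basisMatrixInv b *ᵥ x) = x := by
  rw [mulVec_mulVec, basisMatrix_mul_basisMatrixInv, one_mulVec]

theorem basisMatrixInv_mulVec_basis (i : Fin n₁ ⊕ Fin n₂) :
    basisMatrixInv b *ᵥ b i = Pi.single i 1 := by
  rw [basisMatrixInv_mulVec, Module.Basis.repr_self, Finsupp.single_eq_pi_single]

theorem basisMatrix_mulVec_single (i : Fin n₁ ⊕ Fin n₂) :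
    basisMatrix b *ᵥ Pi.single i 1 = b i := by
  rw [← basisMatrixInv_mulVec_basis, basisMatrix_mulVec_inv]

variable {b} {A : Matrix (Fin n) (Fin n) ℝ} {B : Matrix (Fin n) (Fin m) ℝ}

theorem IsKalmanBasis.inv_mulVec_inr (hb : IsKalmanBasis A B b) {x : Fin n → ℝ}
    (hx : x ∈ controllableSubspace A B) (i : Fin n₂) :
    (basisMatrixInv b *ᵥ x) (Sum.inr i) = 0 := by
  rw [← hb] at hx
  have : Submodule.span ℝ (Set.range fun i : Fin n₁ => b (Sum.inl i)) ≤
      LinearMap.ker (b.coord (Sum.inr i)) := by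
    rw [Submodule.span_le]
    rintro _ ⟨j, rfl⟩
    simp
  rw [basisMatrixInv_mulVec]
  exact this hx

theorem IsKalmanBasis.basis_inl_mem (hb : IsKalmanBasis A B b) (i : Fin n₁) :
    b (Sum.inl i) ∈ controllableSubspace A B :=
  hb ▸ Submodule.subset_span ⟨i, rfl⟩

theorem IsKalmanBasis.conj_toBlocks₂₁ (hb : IsKalmanBasis A B b) :
    (basisMatrixInv b * A * basisMatrix b).toBlocks₂₁ = 0 := by
  ext i j
  have := hb.inv_mulVec_inr (mulVec_mem_controllableSubspace (hb.basis_inl_mem j)) i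
  rw [← basisMatrix_mulVec_single, mulVec_mulVec, mulVec_mulVec, mulVec_single_one] at this
  exact this

theorem IsKalmanBasis.inv_mul_toRows₂ (hb : IsKalmanBasis A B b) :
    (basisMatrixInv b * B).toRows₂ = 0 := by
  ext i j
  have := hb.inv_mulVec_inr (pow_mulVec_mem_controllableSubspace A B 0 (Pi.single j 1)) i
  rw [pow_zero, one_mulVec, mulVec_mulVec, mulVec_single_one] at this
  exact this

/-- The block of `T⁻¹ A T` acting on the quotient by the controllable subspace. -/
noncomputable def quotientBlock (b : Module.Basis (Fin n₁ ⊕ Fin n₂) ℝ (Fin n → ℝ))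
    (A : Matrix (Fin n) (Fin n) ℝ) : Matrix (Fin n₂) (Fin n₂) ℝ :=
  (basisMatrixInv b * A * basisMatrix b).toBlocks₂₂

theorem IsKalmanBasis.conj_eq (hb : IsKalmanBasis A B b) :
    basisMatrixInv b * A * basisMatrix b = fromBlocks (blockA b A)
      (basisMatrixInv b * A * basisMatrix b).toBlocks₁₂ 0 (quotientBlock b A) := by
  conv_lhs => rw [← fromBlocks_toBlocks (basisMatrixInv b * A * basisMatrix b), hb.conj_toBlocks₂₁]
  rfl

theorem IsKalmanBasis.inv_mul_eq (hb : IsKalmanBasis A B b) :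
    basisMatrixInv b * B = fromRows (blockB b B) 0 := by
  conv_lhs => rw [← fromRows_toRows (basisMatrixInv b * B), hb.inv_mul_toRows₂]
  rfl

theorem inv_mulVec_mulVec (b : Module.Basis (Fin n₁ ⊕ Fin n₂) ℝ (Fin n → ℝ))
    (A : Matrix (Fin n) (Fin n) ℝ) (x : Fin n → ℝ) :
    basisMatrixInv b *ᵥ (A *ᵥ x) =
      (basisMatrixInv b * A * basisMatrix b) *ᵥ (basisMatrixInv b *ᵥ x) := by
  rw [mulVec_mulVec, mulVec_mulVec, Matrix.mul_assoc (basisMatrixInv b * A),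
    basisMatrix_mul_basisMatrixInv, Matrix.mul_one]

theorem IsKalmanBasis.inv_mulVec_pow (hb : IsKalmanBasis A B b) (k : ℕ) (y : Fin m → ℝ) :
    basisMatrixInv b *ᵥ ((A ^ k) *ᵥ (B *ᵥ y)) =
      Sum.elim ((blockA b A ^ k) *ᵥ (blockB b B *ᵥ y)) 0 := by
  induction k with
  | zero =>
    rw [pow_zero, pow_zero, one_mulVec, one_mulVec, mulVec_mulVec, hb.inv_mul_eq, fromRows_mulVec,
      zero_mulVec]
  | succ k ih =>
    rw [pow_succ', ← mulVec_mulVec, inv_mulVec_mulVec, ih, hb.conj_eq, fromBlocks_mulVec, pow_succ',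
      ← mulVec_mulVec]
    simp

/-- A covector killing all `A₁ ^ k B₁`, extended by zero, is a functional vanishing on the
controllable subspace. Its values at the first group of basis vectors are its own coordinates. -/
theorem IsKalmanBasis.controllable (hb : IsKalmanBasis A B b) :
    Controllable (blockA b A) (blockB b B * (blockB b B)ᵀ) := by
  intro v hv
  have hv' : ∀ k, (blockB b B)ᵀ *ᵥ (((blockA b A)ᵀ ^ k) *ᵥ v) = 0 := fun k => by
    have := hv k
    rwa [← conjTranspose_eq_transpose_of_trivial (blockB b B),
      self_mul_conjTranspose_mulVec_eq_zero, conjTranspose_eq_transpose_of_trivial] at this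
  let φ : (Fin n → ℝ) →ₗ[ℝ] ℝ :=
    (dotProductBilin ℝ ℝ (Sum.elim v 0 : Fin n₁ ⊕ Fin n₂ → ℝ)) ∘ₗ (basisMatrixInv b).mulVecLin
  have hφ : ∀ x, φ x = Sum.elim v 0 ⬝ᵥ (basisMatrixInv b *ᵥ x) := fun x => rfl
  have hle : controllableSubspace A B ≤ LinearMap.ker φ := by
    refine controllableSubspace_le fun k y => ?_
    rw [LinearMap.mem_ker, hφ, hb.inv_mulVec_pow, sumElim_dotProduct_sumElim, dotProduct_zero,
      add_zero, dotProduct_mulVec, dotProduct_mulVec, ← mulVec_transpose, ← mulVec_transpose,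
      transpose_pow, hv' k, zero_dotProduct]
  funext j
  have := hle (hb.basis_inl_mem j)
  rw [LinearMap.mem_ker, hφ, basisMatrixInv_mulVec_basis, dotProduct_single_one] at this
  exact this

theorem charpoly_conj (b : Module.Basis (Fin n₁ ⊕ Fin n₂) ℝ (Fin n → ℝ))
    (M : Matrix (Fin n) (Fin n) ℝ) :
    (basisMatrixInv b * M * basisMatrix b).charpoly = M.charpoly := by
  have hcard : Fintype.card (Fin n₁ ⊕ Fin n₂) = Fintype.card (Fin n) := by
    rw [← Module.finrank_eq_card_basis b, Module.finrank_fin_fun, Fintype.card_fin]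
  have h := charpoly_mul_comm_of_le (basisMatrixInv b * M) (basisMatrix b) hcard.ge
  rwa [hcard, Nat.sub_self, pow_zero, one_mul, ← Matrix.mul_assoc, basisMatrix_mul_basisMatrixInv,
    Matrix.one_mul] at h

/-- The lower rows of `T⁻¹ B` vanish, so feedback leaves the lower right block of the triangular
form unchanged. -/
theorem IsKalmanBasis.quotientBlock_charpoly_dvd (hb : IsKalmanBasis A B b)
    (F : Matrix (Fin m) (Fin n) ℝ) : (quotientBlock b A).charpoly ∣ (A + B * F).charpoly := by
  have e : basisMatrixInv b * (A + B * F) * basisMatrix b =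
      fromBlocks (blockA b A + blockB b B * (F * basisMatrix b).toCols₁)
        ((basisMatrixInv b * A * basisMatrix b).toBlocks₁₂ +
          blockB b B * (F * basisMatrix b).toCols₂) 0 (quotientBlock b A) := by
    rw [Matrix.mul_add, Matrix.add_mul, ← Matrix.mul_assoc, hb.inv_mul_eq,
      Matrix.mul_assoc (fromRows _ 0), hb.conj_eq,
      ← fromCols_toCols (F * basisMatrix b), fromRows_mul_fromCols, fromBlocks_add]
    simp
  rw [← charpoly_conj b, e, charpoly_fromBlocks_zero₂₁]
  exact dvd_mul_left _ _

theorem IsKalmanBasis.re_neg_of_stabilizable (hb : IsKalmanBasis A B b) (h : Stabilizable A B)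
    {s : ℂ} (hs : s ∈ eigenvalues (quotientBlock b A)) : s.re < 0 := by
  obtain ⟨F, hF⟩ := h
  refine hF s ?_
  rw [eigenvalues, mem_spectrum_iff_isRoot_charpoly, charpoly_map] at hs ⊢
  exact hs.dvd (Polynomial.map_dvd _ (hb.quotientBlock_charpoly_dvd F))

theorem IsKalmanBasis.imaginaryObservable_iff (hb : IsKalmanBasis A B b) (h : Stabilizable A B)
    {Q : Matrix (Fin n) (Fin n) ℝ} (hQ : Q.PosSemidef) (hQ₁ : (blockQ b Q).PosSemidef) :
    ImaginaryObservable A Q ↔ ImaginaryObservable (blockA b A) (blockQ b Q) := by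
  have hform : ∀ u : Fin n₁ → ℝ, u ⬝ᵥ (blockQ b Q *ᵥ u) =
      (basisMatrix b *ᵥ Sum.elim u 0) ⬝ᵥ (Q *ᵥ (basisMatrix b *ᵥ Sum.elim u 0)) := fun u => by
    have e : (basisMatrix b *ᵥ Sum.elim u 0) ⬝ᵥ (Q *ᵥ (basisMatrix b *ᵥ Sum.elim u 0)) =
        Sum.elim u 0 ⬝ᵥ (((basisMatrix b)ᵀ * Q * basisMatrix b) *ᵥ Sum.elim u 0) := by
      rw [← mulVec_mulVec, ← mulVec_mulVec, dotProduct_mulVec _ (basisMatrix b)ᵀ, vecMul_transpose]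
    rw [e, ← fromBlocks_toBlocks ((basisMatrix b)ᵀ * Q * basisMatrix b), fromBlocks_mulVec,
      sumElim_dotProduct_sumElim]
    simp [blockQ]
  -- Semidefiniteness is essential: `Q₁ u = 0` controls only the upper block directly, but it makes
  -- the quadratic form of `Q` vanish, hence `Q` itself on that vector.
  have hker : ∀ u : Fin n₁ → ℝ,
      blockQ b Q *ᵥ u = 0 ↔ Q *ᵥ (basisMatrix b *ᵥ Sum.elim u 0) = 0 := fun u =>
    ⟨fun hu => hQ.mulVec_eq_zero (by rw [← hform, hu, dotProduct_zero]),
      fun hu => hQ₁.mulVec_eq_zero (by rw [hform, hu, dotProduct_zero])⟩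
  have hinj : ∀ z, basisMatrix b *ᵥ z = 0 → z = 0 := fun z hz => by
    rw [← one_mulVec z, ← basisMatrixInv_mul_basisMatrix b, ← mulVec_mulVec, hz, mulVec_zero]
  have hAT : ∀ z, A *ᵥ (basisMatrix b *ᵥ z) = basisMatrix b *ᵥ
      ((basisMatrixInv b * A * basisMatrix b) *ᵥ z) := fun z => by
    rw [mulVec_mulVec, mulVec_mulVec, ← Matrix.mul_assoc, ← Matrix.mul_assoc,
      basisMatrix_mul_basisMatrixInv,
      Matrix.one_mul]
  have hblock : ∀ u : Fin n₁ → ℝ, (basisMatrixInv b * A * basisMatrix b) *ᵥ Sum.elim u 0 =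
      Sum.elim (blockA b A *ᵥ u) 0 := fun u => by
    rw [hb.conj_eq, fromBlocks_mulVec]
    simp
  have hsmul : ∀ (c : ℝ) (u : Fin n₁ → ℝ),
      (Sum.elim (c • u) 0 : Fin n₁ ⊕ Fin n₂ → ℝ) = c • Sum.elim u 0 := fun c u => by
    ext (i | i) <;> simp
  have hadd : ∀ u w : Fin n₁ → ℝ,
      (Sum.elim (u + w) 0 : Fin n₁ ⊕ Fin n₂ → ℝ) = Sum.elim u 0 + Sum.elim w 0 := fun u w => by
    ext (i | i) <;> simp
  have hsub : ∀ u w : Fin n₁ → ℝ,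
      (Sum.elim (u - w) 0 : Fin n₁ ⊕ Fin n₂ → ℝ) = Sum.elim u 0 - Sum.elim w 0 := fun u w => by
    ext (i | i) <;> simp
  have hpair : ∀ (s : ℂ) (u w : Fin n₁ → ℝ), IsEigenPair (blockA b A) s u w ↔
      IsEigenPair A s (basisMatrix b *ᵥ Sum.elim u 0) (basisMatrix b *ᵥ Sum.elim w 0) := by
    intro s u w
    have hcancel : ∀ z z' : Fin n₁ → ℝ, basisMatrix b *ᵥ Sum.elim z 0 =
        basisMatrix b *ᵥ Sum.elim z' 0 ↔ z = z' := fun z z' => by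
      refine ⟨fun h => ?_, fun h => h ▸ rfl⟩
      have h0 := hinj (Sum.elim (z - z') 0) (by rw [hsub, mulVec_sub, h, sub_self])
      funext i
      simpa [sub_eq_zero] using congrFun h0 (Sum.inl i)
    rw [IsEigenPair, IsEigenPair, hAT, hAT, hblock, hblock, ← mulVec_smul, ← mulVec_smul,
      ← mulVec_smul, ← mulVec_smul, ← mulVec_sub, ← mulVec_add, ← hsmul, ← hsmul, ← hsmul, ← hsmul,
      ← hsub, ← hadd, hcancel, hcancel]
  constructor
  · intro hobs s u w hs hp hu hw
    obtain ⟨h1, h2⟩ := hobs s _ _ hs ((hpair s u w).1 hp) ((hker u).1 hu) ((hker w).1 hw)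
    refine ⟨funext fun i => congrFun (hinj _ h1) (Sum.inl i),
      funext fun i => congrFun (hinj _ h2) (Sum.inl i)⟩
  · intro hobs s u w hs hp hu hw
    have hlow : ∀ x, (fun i => (basisMatrixInv b *ᵥ (A *ᵥ x)) (Sum.inr i)) =
        quotientBlock b A *ᵥ fun i => (basisMatrixInv b *ᵥ x) (Sum.inr i) := fun x => by
      rw [inv_mulVec_mulVec, hb.conj_eq, fromBlocks_mulVec]
      funext i
      simp [Function.comp_def]
    have hp₂ : IsEigenPair (quotientBlock b A) s (fun i => (basisMatrixInv b *ᵥ u) (Sum.inr i))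
        (fun i => (basisMatrixInv b *ᵥ w) (Sum.inr i)) := by
      rw [IsEigenPair, ← hlow, ← hlow, hp.1, hp.2, mulVec_sub, mulVec_add, mulVec_smul,
        mulVec_smul, mulVec_smul, mulVec_smul]
      exact ⟨rfl, rfl⟩
    -- Otherwise the quotient coordinates would form an eigenvector of `A₂` with an imaginary
    -- eigenvalue.
    have hzero : (fun i => (basisMatrixInv b *ᵥ u) (Sum.inr i)) = 0 ∧
        (fun i => (basisMatrixInv b *ᵥ w) (Sum.inr i)) = 0 := by
      by_contra hne
      set x : Fin n₂ → ℂ := fun i =>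
        ⟨(basisMatrixInv b *ᵥ u) (Sum.inr i), (basisMatrixInv b *ᵥ w) (Sum.inr i)⟩
      have hmem : s ∈ eigenvalues (quotientBlock b A) :=
        mem_spectrum_iff_exists_mulVec.2 ⟨x, fun h0 => hne (eq_zero_iff_re_im.1 h0),
          map_mulVec_eq_smul_iff.2 hp₂⟩
      exact (hb.re_neg_of_stabilizable h hmem).ne hs
    have hrec : ∀ x, (fun i => (basisMatrixInv b *ᵥ x) (Sum.inr i)) = 0 →
        ∃ z : Fin n₁ → ℝ, x = basisMatrix b *ᵥ Sum.elim z 0 := fun x hx => by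
      refine ⟨fun i => (basisMatrixInv b *ᵥ x) (Sum.inl i), ?_⟩
      conv_lhs => rw [← basisMatrix_mulVec_inv b x]
      congr 1
      ext (i | i)
      · rfl
      · exact congrFun hx i
    obtain ⟨u, rfl⟩ := hrec u hzero.1
    obtain ⟨w, rfl⟩ := hrec w hzero.2
    obtain ⟨rfl, rfl⟩ := hobs s u w hs ((hpair s u w).2 hp) ((hker u).2 hu) ((hker w).2 hw)
    simp

theorem blockQ_posSemidef (b : Module.Basis (Fin n₁ ⊕ Fin n₂) ℝ (Fin n → ℝ))
    {Q : Matrix (Fin n) (Fin n) ℝ} (hQ : Q.PosSemidef) : (blockQ b Q).PosSemidef := by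
  have := (hQ.conjTranspose_mul_mul_same (basisMatrix b)).submatrix Sum.inl
  rwa [conjTranspose_eq_transpose_of_trivial] at this

end Kalman

theorem mem_areSolutions_iff {n m : ℕ} {A : Matrix (Fin n) (Fin n) ℝ}
    {B : Matrix (Fin n) (Fin m) ℝ} {Q K : Matrix (Fin n) (Fin n) ℝ} :
    K ∈ areSolutions A B Q ↔ K.IsSymm ∧ riccati A (B * Bᵀ) Q K = 0 := by
  rw [areSolutions, Set.mem_ofPred_eq, riccati, Matrix.mul_assoc K B]

end LQ

theorem theorem5p4 {n m n₁ n₂ : ℕ}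
    (A : Matrix (Fin n) (Fin n) ℝ) (B : Matrix (Fin n) (Fin m) ℝ) (Q : Matrix (Fin n) (Fin n) ℝ)
    (hAB : LQ.Stabilizable A B) (hQ : Q.PosSemidef)
    (b : Module.Basis (Fin n₁ ⊕ Fin n₂) ℝ (Fin n → ℝ)) (hb : LQ.IsKalmanBasis A B b) :
    ∃ Kplus Kminus : Matrix (Fin n₁) (Fin n₁) ℝ,
      LQ.IsMaximalElement
        (LQ.areSolutions (LQ.blockA b A) (LQ.blockB b B) (LQ.blockQ b Q)) Kplus ∧
      LQ.IsMinimalElement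
        (LQ.areSolutions (LQ.blockA b A) (LQ.blockB b B) (LQ.blockQ b Q)) Kminus ∧
      ((∀ s ∈ LQ.eigenvalues A, s.re = 0 → LQ.ObservableAt Q A s) ↔
        (Kplus - Kminus).PosDef) := by
  have hS : (LQ.blockB b B * (LQ.blockB b B).transpose).PosSemidef := by
    have := Matrix.posSemidef_self_mul_conjTranspose (LQ.blockB b B)
    rwa [Matrix.conjTranspose_eq_transpose_of_trivial] at this
  have hQ₁ := LQ.blockQ_posSemidef b hQ
  obtain ⟨K, L, hK, hL, hKe, hLe, hmax, hmin, hiff⟩ :=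
    LQ.exists_extremal_riccati hb.controllable hS hQ₁
  refine ⟨K, L, ⟨LQ.mem_areSolutions_iff.2 ⟨hK, hKe⟩, fun X hX => ?_⟩,
    ⟨LQ.mem_areSolutions_iff.2 ⟨hL, hLe⟩, fun X hX => ?_⟩, ?_⟩
  · obtain ⟨h1, h2⟩ := LQ.mem_areSolutions_iff.1 hX
    exact hmax X h1 h2
  · obtain ⟨h1, h2⟩ := LQ.mem_areSolutions_iff.1 hX
    exact hmin X h1 h2
  · rw [LQ.forall_observableAt_iff, hb.imaginaryObservable_iff hAB hQ hQ₁, hiff]
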